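/- **Theorem 5.1.** Conventions. For real topological vector spaces $E,F$, let $E_{\mathbb C}=E\oplus iE$ (with the product topology of $E\times E$) and $F_{\mathbb C}$ denote the complexifications. A map $g\colon V\to F_{\mathbb C}$ on an open set $V\subseteq E_{\mathbb C}$ is *holomorphic* if it is continuous, all directional derivatives $dg(z)(h)=\lim_{t\to 0,\,t\in\mathbb R}\frac1t\,(g(z+th)-g(z))$ ($z\in V$, $h\in E_{\mathbb C}$) exist, the map $dg\colon V\times E_{\mathbb C}\to F_{\mathbb C}$ is continuous, and each $dg(z)$ is complex linear. A map $f\colon U\to F$ on an open set $U\subseteq E$ is *analytic* if every $x\in U$ has an open neighborhood $V\subseteq E_{\mathbb C}$ for which there is a holomorphic map $g\colon V\to F_{\mathbb C}$ with $g=f$ on $U\cap V$. An *analytic Fréchet manifold* is a manifold modelled on a real Fréchet space (a complete metrizable locally convex space) whose chart changes are analytic; a map from an open subset of such a manifold to a real locally convex space is *analytic* if its local representatives in all charts are analytic. A complex Hilbert space and $\mathbb C$ are regarded as real locally convex spaces when analyticity of maps into them is considered. Let $M$ be an analytic Fréchet manifold, let $\mathcal H$ be a real or complex Hilbert space, and let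 $\gamma\colon M\to\mathcal H$ be an arbitrary map. Then $\gamma$ is analytic on $M$ if and only if there is an open neighborhood $W$ of the diagonal in the product manifold $M\times M$ on which the kernel $$K(x,y):=\langle \gamma(x),\gamma(y)\rangle$$ is analytic. -/

import Mathlib

open scoped Topology

/-- The complexification of a real vector space `E`: the pair `(x, y)` stands for `x + i y`.
If `E` is a topological vector space, it carries the product topology of `E × E`. -/
def Complexification (E : Type*) : Type _ := E × E

namespace Complexification

instance (E : Type*) [AddCommGroup E] : AddCommGroup (Complexification E) :=
  inferInstanceAs (AddCommGroup (E × E))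

instance (E : Type*) [TopologicalSpace E] : TopologicalSpace (Complexification E) :=
  inferInstanceAs (TopologicalSpace (E × E))

/-- `(a + i b) (x + i y) = (a x - b y) + i (a y + b x)`. -/
instance (E : Type*) [AddCommGroup E] [Module ℝ E] : SMul ℂ (Complexification E) where
  smul c z := (c.re • z.1 - c.im • z.2, c.re • z.2 + c.im • z.1)

/-- The complex vector space structure. The underlying real vector space structure used below is
the restriction of scalars of this one. -/
instance (E : Type*) [AddCommGroup E] [Module ℝ E] : Module ℂ (Complexification E) where
  one_smul z := by
    change (((1 : ℂ).re • z.1 - (1 : ℂ).im • z.2, (1 : ℂ).re • z.2 + (1 : ℂ).im • z.1) : E × E)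
      = (z.1, z.2)
    simp
  mul_smul c d z := by
    change (((c * d).re • z.1 - (c * d).im • z.2, (c * d).re • z.2 + (c * d).im • z.1) : E × E)
      = (c.re • (d.re • z.1 - d.im • z.2) - c.im • (d.re • z.2 + d.im • z.1),
        c.re • (d.re • z.2 + d.im • z.1) + c.im • (d.re • z.1 - d.im • z.2))
    rw [Complex.mul_re, Complex.mul_im, Prod.mk.injEq]
    constructor <;> module
  smul_zero c := by
    change ((c.re • (0 : E) - c.im • (0 : E), c.re • (0 : E) + c.im • (0 : E)) : E × E) = (0, 0)
    simp
  smul_add c z w := by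
    change ((c.re • (z.1 + w.1) - c.im • (z.2 + w.2),
        c.re • (z.2 + w.2) + c.im • (z.1 + w.1)) : E × E)
      = ((c.re • z.1 - c.im • z.2) + (c.re • w.1 - c.im • w.2),
        (c.re • z.2 + c.im • z.1) + (c.re • w.2 + c.im • w.1))
    rw [Prod.mk.injEq]
    constructor <;> module
  add_smul c d z := by
    change (((c + d).re • z.1 - (c + d).im • z.2, (c + d).re • z.2 + (c + d).im • z.1) : E × E)
      = ((c.re • z.1 - c.im • z.2) + (d.re • z.1 - d.im • z.2),
        (c.re • z.2 + c.im • z.1) + (d.re • z.2 + d.im • z.1))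
    rw [Complex.add_re, Complex.add_im, Prod.mk.injEq]
    constructor <;> module
  zero_smul z := by
    change (((0 : ℂ).re • z.1 - (0 : ℂ).im • z.2, (0 : ℂ).re • z.2 + (0 : ℂ).im • z.1) : E × E)
      = (0, 0)
    simp

/-- The canonical embedding `x ↦ x + i 0` of `E` into its complexification. -/
def ofReal {E : Type*} [AddCommGroup E] (x : E) : Complexification E := ((x, 0) : E × E)

end Complexification

/-- `d` is the derivative of `f` at `x` in the direction `h`: the limit of
`(1 / t) (f (x + t h) - f x)` as the real number `t ≠ 0` tends to `0`. -/
def HasDirectionalDeriv {E F : Type*} [AddCommGroup E] [Module ℝ E]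
    [AddCommGroup F] [Module ℝ F] [TopologicalSpace F] (f : E → F) (x h : E) (d : F) : Prop :=
  Filter.Tendsto (fun t : ℝ => t⁻¹ • (f (x + t • h) - f x)) (𝓝[≠] 0) (𝓝 d)

/-- Holomorphic maps between complex topological vector spaces, on an open set `U`: `f` is a
`C¹`-map in the sense of directional derivatives (`f` is continuous, all its directional derivatives
`df x h` exist for `x ∈ U`, and `(x, h) ↦ df x h` is continuous on `U × E`), and `df x` is complex
linear for all `x ∈ U`. -/
def IsHolomorphicOn {E F : Type*} [AddCommGroup E] [Module ℂ E] [TopologicalSpace E]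
    [AddCommGroup F] [Module ℂ F] [TopologicalSpace F] (f : E → F) (U : Set E) : Prop :=
  ContinuousOn f U ∧ ∃ df : E → E → F,
    (∀ x ∈ U, ∀ h : E, HasDirectionalDeriv f x h (df x h)) ∧
    ContinuousOn (fun p : E × E => df p.1 p.2) (U ×ˢ Set.univ) ∧
    ∀ x ∈ U, IsLinearMap ℂ (df x)

/-- Real analytic maps between real locally convex spaces, on an open set `U`: around every point
of `U`, the map `f` extends to a holomorphic map from an open subset of the complexification of `E`
to the complexification of `F`. -/
def IsRealAnalyticOn {E F : Type*} [AddCommGroup E] [Module ℝ E] [TopologicalSpace E]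
    [AddCommGroup F] [Module ℝ F] [TopologicalSpace F] (f : E → F) (U : Set E) : Prop :=
  ∀ x ∈ U, ∃ V : Set (Complexification E), IsOpen V ∧ Complexification.ofReal x ∈ V ∧
    ∃ g : Complexification E → Complexification F, IsHolomorphicOn g V ∧
      ∀ y ∈ U, Complexification.ofReal y ∈ V →
        g (Complexification.ofReal y) = Complexification.ofReal (f y)

/-- `M` is a real analytic manifold modelled on `E`: all changes of charts are real analytic. -/
class IsRealAnalyticManifold (E : Type*) [AddCommGroup E] [Module ℝ E] [TopologicalSpace E]
    (M : Type*) [TopologicalSpace M] [ChartedSpace E M] : Prop where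
  analytic_transition : ∀ e ∈ atlas E M, ∀ e' ∈ atlas E M,
    IsRealAnalyticOn (e.symm.trans e' : E → E) (e.symm.trans e').source

/-- A map `f` on a manifold `M` modelled on `E`, with values in a locally convex space, is real
analytic on the open set `W`: in every chart, its local representative is real analytic. -/
def IsManifoldAnalyticOn (E : Type*) [AddCommGroup E] [Module ℝ E] [TopologicalSpace E]
    {M : Type*} [TopologicalSpace M] [ChartedSpace E M]
    {F : Type*} [AddCommGroup F] [Module ℝ F] [TopologicalSpace F]
    (f : M → F) (W : Set M) : Prop :=
  ∀ e ∈ atlas E M, IsRealAnalyticOn (f ∘ e.symm) (e.target ∩ e.symm ⁻¹' W)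

/-- The product manifold `M × M'`, modelled on `E × E'`; its charts are the products of charts. -/
instance instChartedSpaceProdModel (E E' M M' : Type*) [TopologicalSpace E] [TopologicalSpace E']
    [TopologicalSpace M] [TopologicalSpace M'] [ChartedSpace E M] [ChartedSpace E' M'] :
    ChartedSpace (E × E') (M × M') :=
  inferInstanceAs (ChartedSpace (ModelProd E E') (M × M'))

/-!
If `γ` is analytic, so is `(x, y) ↦ ⟨γ x, γ y⟩` on all of `M × M`: the real bilinear inner product
extends to a complex bilinear map of the complexifications, and the product rule shows that it
turns two holomorphic extensions of `γ` into a holomorphic extension of the kernel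
(`IsHolomorphicOn.bilinear`, `IsRealAnalyticOn.inner_prod`).

For the converse, work in a chart around `x₀`, with `f` the local representative of `γ`. Taking
real parts, `H` may be regarded as a real Hilbert space, and the kernel extends to a bounded
holomorphic function `k` on `Ω × Ω`, for a neighbourhood `Ω` of `x₀` in the complexification of
`E`. The extension `F` of `f` is built from the values of `f` by extrapolation: there are nodes
`s ∈ [-1, 1]` and complex weights `c s` with `∑ c s * h s → h i`, at a rate which is uniform over
the holomorphic functions `h` bounded by a fixed constant on the disc of radius `4`
(`exists_interpolation_sequence`, Lagrange interpolation and Cauchy's formula). For `z = x + i y`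
close to `x₀`, put `u_n z = ∑ c s • f (x + s y)`. The inner products of `u_n w` and `u_m z` are
such extrapolations of `k` in both variables, so they converge to `k (w̄, z)` as `n, m → ∞`. Hence
`u_n z` is a Cauchy sequence, its limit `F z` satisfies `⟪F w, F z⟫ = k (w̄, z)`, and `F = f` at
real points (`exists_holomorphic_feature_map`).

That `F` is holomorphic follows from this identity. It is continuous because `‖F z - F w‖²` is
expressed through `k`. The functions `⟪F w, F ·⟫` are holomorphic, and a continuous map which is
holomorphic when tested against its own values is holomorphic (`isHolomorphicOn_of_inner`): on
complex lines it agrees with its Cauchy integral, because the difference of the two is orthogonal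
to all values of `F` and therefore to itself; the Cauchy estimates make the derivative jointly
continuous; and linearity of the derivative is again tested against the values of `F`. -/

open scoped Topology

open Filter Metric ComplexConjugate

/-! ### Extrapolation of holomorphic functions from real points -/

/-- Partial fractions form of the error in Lagrange interpolation of `x ↦ (l - x)⁻¹` at the nodes
`S`; the weights `c s` are the values at `a` of the Lagrange basis polynomials. -/
theorem exists_partialFraction_weights (S : Finset ℝ) (a : ℂ) :
    ∃ c : ℝ → ℂ, ∀ l : ℂ, l ≠ a → (∀ s ∈ S, l ≠ (s : ℂ)) →
      (l - a)⁻¹ - ∑ s ∈ S, c s * (l - s)⁻¹ = (∏ s ∈ S, (a - s) / (l - s)) * (l - a)⁻¹ := by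
  classical
  induction S using Finset.induction_on with
  | empty => exact ⟨0, fun l _ _ => by simp⟩
  | insert t S ht ih =>
    obtain ⟨c, hc⟩ := ih
    set d : ℝ → ℂ := fun s => c s * ((a - t) / (s - t)) with hd
    refine ⟨Function.update d t (1 - ∑ s ∈ S, d s), fun l hla hl => ?_⟩
    have hlt : l - t ≠ 0 := sub_ne_zero.2 (hl t (Finset.mem_insert_self _ _))
    have hla' : l - a ≠ 0 := sub_ne_zero.2 hla
    have hS : ∀ s ∈ S, l ≠ (s : ℂ) := fun s hs => hl s (Finset.mem_insert_of_mem hs)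
    have hsum : ∑ s ∈ S, Function.update d t (1 - ∑ s ∈ S, d s) s * (l - s)⁻¹
        = ∑ s ∈ S, (c s * (l - s)⁻¹ * ((a - t) / (l - t)) + d s * (l - t)⁻¹) := by
      refine Finset.sum_congr rfl fun s hs => ?_
      have hst : s ≠ t := fun h => ht (h ▸ hs)
      rw [Function.update_of_ne hst, hd]
      have h1 : (s : ℂ) - t ≠ 0 := sub_ne_zero.2 (by exact_mod_cast hst)
      have h2 : l - s ≠ 0 := sub_ne_zero.2 (hS s hs)
      field_simp
      ring
    rw [Finset.sum_insert ht, Finset.prod_insert ht, hsum, Function.update_self,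
      Finset.sum_add_distrib, ← Finset.sum_mul, ← Finset.sum_mul, mul_assoc, ← hc l hla hS]
    have h3 : (l - a)⁻¹ * ((a - t) / (l - t)) = (l - a)⁻¹ - (l - t)⁻¹ := by
      field_simp
      ring
    linear_combination -h3

/-- Lagrange interpolation at nodes in `[-1, 1]` approximates holomorphic functions on the disc of
radius `4` at every point `a` of the unit disc, with geometric rate: by Cauchy's formula the error
is `(2πi)⁻¹ ∮ ∏ (a - s) / (z - s) * (z - a)⁻¹ * h z`, where `‖a - s‖ ≤ 2` and `3 ≤ ‖z - s‖`. -/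
theorem exists_interpolation_weights (S : Finset ℝ) (hS : ∀ s ∈ S, |s| ≤ 1) (a : ℂ)
    (ha : ‖a‖ ≤ 1) :
    ∃ c : ℝ → ℂ, ∀ (h : ℂ → ℂ) (C : ℝ), (∀ l ∈ closedBall (0 : ℂ) 4, DifferentiableAt ℂ h l) →
      (∀ l ∈ closedBall (0 : ℂ) 4, ‖h l‖ ≤ C) →
      ‖h a - ∑ s ∈ S, c s * h s‖ ≤ 2 * (2 / 3) ^ S.card * C := by
  obtain ⟨c, hc⟩ := exists_partialFraction_weights S a
  refine ⟨c, fun h C hd hC => ?_⟩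
  have hC0 : 0 ≤ C := (norm_nonneg _).trans (hC 0 (by simp))
  have hcl : DiffContOnCl ℂ h (ball 0 4) := by
    refine DifferentiableOn.diffContOnCl ?_
    rw [closure_ball _ (by norm_num)]
    exact fun l hl => (hd l hl).differentiableWithinAt
  have hcauchy : ∀ w : ℂ, ‖w‖ ≤ 1 →
      (2 * Real.pi * Complex.I)⁻¹ • (∮ z in C(0, 4), (z - w)⁻¹ • h z) = h w := by
    intro w hw
    rw [hcl.circleIntegral_sub_inv_smul (by rw [mem_ball_zero_iff]; linarith), smul_smul,
      inv_mul_cancel₀ Complex.two_pi_I_ne_zero, one_smul]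
  have hne : ∀ w : ℂ, ‖w‖ ≤ 1 → ∀ z ∈ sphere (0 : ℂ) 4, 3 ≤ ‖z - w‖ := by
    intro w hw z hz
    rw [mem_sphere_zero_iff_norm] at hz
    have := norm_sub_norm_le z w
    linarith
  have hint : ∀ w : ℂ, ‖w‖ ≤ 1 → CircleIntegrable (fun z => (z - w)⁻¹ • h z) 0 4 := by
    intro w hw
    refine ContinuousOn.circleIntegrable (by norm_num) ?_
    refine ContinuousOn.smul
      (ContinuousOn.inv₀ (continuousOn_id.sub continuousOn_const) fun z hz h0 => ?_)
      (fun l hl => (hd l (sphere_subset_closedBall hl)).continuousAt.continuousWithinAt)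
    have := hne w hw z hz
    change z - w = 0 at h0
    rw [h0, norm_zero] at this
    norm_num at this
  have hS' : ∀ s ∈ S, ‖(s : ℂ)‖ ≤ 1 := fun s hs => by simpa using hS s hs
  have hint' : ∀ s ∈ S, CircleIntegrable (fun z => c s • ((z - (s : ℂ))⁻¹ • h z)) 0 4 :=
    fun s hs => (hint s (hS' s hs)).const_smul (a := c s)
  have key : h a - ∑ s ∈ S, c s * h s = (2 * Real.pi * Complex.I)⁻¹ •
      ∮ z in C(0, 4), ((∏ s ∈ S, (a - s) / (z - s)) * (z - a)⁻¹) * h z := by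
    have e1 : ∑ s ∈ S, c s * h (s : ℂ) = (2 * Real.pi * Complex.I)⁻¹ •
        ∮ z in C(0, 4), ∑ s ∈ S, c s • ((z - (s : ℂ))⁻¹ • h z) := by
      rw [circleIntegral.integral_fun_sum
        hint', Finset.smul_sum]
      refine Finset.sum_congr rfl fun s hs => ?_
      rw [circleIntegral.integral_smul, smul_comm, hcauchy s (hS' s hs), smul_eq_mul]
    rw [e1, ← hcauchy a ha, ← smul_sub, ← circleIntegral.integral_sub (hint a ha)
      (CircleIntegrable.fun_sum _ hint')]
    congr 1
    refine circleIntegral.integral_congr (by norm_num) fun z hz => ?_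
    have hzw : ∀ w : ℂ, ‖w‖ ≤ 1 → z ≠ w := fun w hw h0 => by
      have := hne w hw z hz
      rw [h0, sub_self, norm_zero] at this
      norm_num at this
    simp only [← hc z (hzw a ha) (fun s hs => hzw s (hS' s hs)), smul_eq_mul, sub_mul,
      Finset.sum_mul, mul_assoc]
  rw [key]
  refine (circleIntegral.norm_two_pi_i_inv_smul_integral_le_of_norm_le_const (by norm_num)
    (C := (2 / 3) ^ S.card * (1 / 3) * C) fun z hz => ?_).trans ?_
  · rw [norm_mul, norm_mul, norm_prod]
    refine mul_le_mul (mul_le_mul ?_ ?_ (norm_nonneg _) (by positivity))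
      (hC z (sphere_subset_closedBall hz)) (norm_nonneg _) (by positivity)
    · rw [← Finset.prod_const]
      refine Finset.prod_le_prod (fun _ _ => norm_nonneg _) fun s hs => ?_
      have h1 := hne s (hS' s hs) z hz
      have h2 : ‖a - s‖ ≤ 2 := (norm_sub_le _ _).trans (by linarith [hS' s hs])
      rw [norm_div]
      exact div_le_div₀ (by norm_num) h2 (by norm_num) h1
    · rw [norm_inv, one_div]
      exact inv_anti₀ (by norm_num) (hne a ha z hz)
  · have : 0 ≤ (2 / 3 : ℝ) ^ S.card * C := by positivity
    nlinarith

theorem exists_interpolation_sequence :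
    ∃ (S : ℕ → Finset ℝ) (c : ℕ → ℝ → ℂ) (ε : ℕ → ℝ), Tendsto ε atTop (𝓝 0) ∧
      (∀ n, ∀ s ∈ S n, |s| ≤ 1) ∧
      ∀ (n : ℕ) (h : ℂ → ℂ) (C : ℝ), (∀ l ∈ closedBall (0 : ℂ) 4, DifferentiableAt ℂ h l) →
        (∀ l ∈ closedBall (0 : ℂ) 4, ‖h l‖ ≤ C) →
        ‖h Complex.I - ∑ s ∈ S n, c n s * h s‖ ≤ ε n * C := by
  set S : ℕ → Finset ℝ := fun n => (Finset.range n).image fun k : ℕ => 1 / ((k : ℝ) + 1) with hS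
  have hcard : ∀ n, (S n).card = n := fun n => by
    rw [hS, Finset.card_image_of_injective, Finset.card_range]
    intro k l hkl
    simpa using hkl
  have hle : ∀ n, ∀ s ∈ S n, |s| ≤ 1 := by
    intro n s hs
    obtain ⟨k, -, rfl⟩ := Finset.mem_image.1 hs
    rw [abs_of_nonneg (by positivity), div_le_one (by positivity)]
    linarith [(Nat.cast_nonneg k : (0 : ℝ) ≤ k)]
  choose c hc using fun n => exists_interpolation_weights (S n) (hle n) Complex.I (by simp)
  refine ⟨S, c, fun n => 2 * (2 / 3) ^ n, ?_, hle, fun n h C hd hC => ?_⟩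
  · simpa using (tendsto_pow_atTop_nhds_zero_of_lt_one (r := (2 / 3 : ℝ)) (by norm_num)
      (by norm_num)).const_mul 2
  · simpa [hcard] using hc n h C hd hC

/-- The conjugate weights extrapolate to `-i`, because the nodes are real. -/
theorem conj_interpolation_bound {S : Finset ℝ} {c : ℝ → ℂ} {ε : ℝ}
    (hc : ∀ (h : ℂ → ℂ) (C : ℝ), (∀ l ∈ closedBall (0 : ℂ) 4, DifferentiableAt ℂ h l) →
      (∀ l ∈ closedBall (0 : ℂ) 4, ‖h l‖ ≤ C) → ‖h Complex.I - ∑ s ∈ S, c s * h s‖ ≤ ε * C)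
    {h : ℂ → ℂ} {C : ℝ} (hd : ∀ l ∈ closedBall (0 : ℂ) 4, DifferentiableAt ℂ h l)
    (hC : ∀ l ∈ closedBall (0 : ℂ) 4, ‖h l‖ ≤ C) :
    ‖h (-Complex.I) - ∑ s ∈ S, conj (c s) * h s‖ ≤ ε * C := by
  have hmem : ∀ l ∈ closedBall (0 : ℂ) 4, conj l ∈ closedBall (0 : ℂ) 4 := fun l hl => by
    simpa using hl
  have hd' : ∀ l ∈ closedBall (0 : ℂ) 4, DifferentiableAt ℂ (conj ∘ h ∘ conj) l :=
    fun l hl => differentiableAt_conj_conj_iff.2 (hd _ (hmem l hl))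
  have := hc _ C hd' fun l hl => by simpa using hC _ (hmem l hl)
  rw [← Complex.norm_conj] at this
  simpa using this

/-- Extrapolation in two variables at once. Separate holomorphy and a common bound suffice: the
error of the extrapolation in the second variable is a small holomorphic function of the first
one. -/
theorem tendsto_double_interpolation {S : ℕ → Finset ℝ} {c : ℕ → ℝ → ℂ} {ε : ℕ → ℝ}
    (hε : Tendsto ε atTop (𝓝 0)) (hS : ∀ n, ∀ s ∈ S n, |s| ≤ 1)
    (hc : ∀ (n : ℕ) (h : ℂ → ℂ) (C : ℝ), (∀ l ∈ closedBall (0 : ℂ) 4, DifferentiableAt ℂ h l) →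
        (∀ l ∈ closedBall (0 : ℂ) 4, ‖h l‖ ≤ C) →
        ‖h Complex.I - ∑ s ∈ S n, c n s * h s‖ ≤ ε n * C)
    {h : ℂ → ℂ → ℂ} {C : ℝ}
    (h1 : ∀ s ∈ closedBall (0 : ℂ) 4, ∀ t ∈ closedBall (0 : ℂ) 4,
      DifferentiableAt ℂ (fun s => h s t) s)
    (h2 : ∀ s ∈ closedBall (0 : ℂ) 4, ∀ t ∈ closedBall (0 : ℂ) 4, DifferentiableAt ℂ (h s) t)
    (hC : ∀ s ∈ closedBall (0 : ℂ) 4, ∀ t ∈ closedBall (0 : ℂ) 4, ‖h s t‖ ≤ C) :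
    Tendsto (fun p : ℕ × ℕ => ∑ s ∈ S p.1, ∑ t ∈ S p.2, conj (c p.1 s) * (c p.2 t * h s t))
      (atTop ×ˢ atTop) (𝓝 (h (-Complex.I) Complex.I)) := by
  have hI : Complex.I ∈ closedBall (0 : ℂ) 4 := by simp
  have hI' : -Complex.I ∈ closedBall (0 : ℂ) 4 := by simp
  have hSm : ∀ n, ∀ s ∈ S n, (s : ℂ) ∈ closedBall (0 : ℂ) 4 := fun n s hs => by
    simpa using (hS n s hs).trans (by norm_num)
  have key : ∀ p : ℕ × ℕ, ‖(∑ s ∈ S p.1, ∑ t ∈ S p.2, conj (c p.1 s) * (c p.2 t * h s t))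
      - h (-Complex.I) Complex.I‖ ≤ ε p.2 * C + ε p.1 * (ε p.2 * C) + ε p.1 * C := by
    rintro ⟨n, m⟩
    -- `r` is the error of the extrapolation in the second variable.
    set r : ℂ → ℂ := fun s => h s Complex.I - ∑ t ∈ S m, c m t * h s t with hr
    have hrd : ∀ s ∈ closedBall (0 : ℂ) 4, DifferentiableAt ℂ r s := fun s hs =>
      (h1 s hs _ hI).sub
        (DifferentiableAt.fun_sum fun t ht => (h1 s hs t (hSm m t ht)).const_mul (c m t))
    have hrb : ∀ s ∈ closedBall (0 : ℂ) 4, ‖r s‖ ≤ ε m * C := fun s hs =>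
      hc m (h s) C (h2 s hs) (hC s hs)
    have b1 := conj_interpolation_bound (hc n) hrd hrb
    have b2 := conj_interpolation_bound (hc n) (fun s hs => h1 s hs _ hI) fun s hs => hC s hs _ hI
    have b3 := hrb _ hI'
    have e : (∑ s ∈ S n, ∑ t ∈ S m, conj (c n s) * (c m t * h s t)) - h (-Complex.I) Complex.I
        = (r (-Complex.I) - ∑ s ∈ S n, conj (c n s) * r s) - r (-Complex.I)
          - (h (-Complex.I) Complex.I - ∑ s ∈ S n, conj (c n s) * h s Complex.I) := by
      simp only [hr, mul_sub, Finset.sum_sub_distrib, ← Finset.mul_sum]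
      ring
    simp only
    rw [e]
    refine (norm_sub_le _ _).trans ?_
    have := norm_sub_le (r (-Complex.I) - ∑ s ∈ S n, conj (c n s) * r s) (r (-Complex.I))
    linarith
  rw [tendsto_iff_norm_sub_tendsto_zero]
  refine squeeze_zero (fun _ => norm_nonneg _) key ?_
  have t1 : Tendsto (fun p : ℕ × ℕ => ε p.1) (atTop ×ˢ atTop) (𝓝 0) := hε.comp tendsto_fst
  have t2 : Tendsto (fun p : ℕ × ℕ => ε p.2) (atTop ×ˢ atTop) (𝓝 0) := hε.comp tendsto_snd
  simpa using ((t2.mul_const C).add (t1.mul (t2.mul_const C))).add (t1.mul_const C)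

/-! ### Complexifications as topological vector spaces and as Hilbert spaces -/

namespace Complexification

section TopologicalVectorSpace

variable {E : Type*} [AddCommGroup E] [Module ℝ E] [TopologicalSpace E]

instance [IsTopologicalAddGroup E] : IsTopologicalAddGroup (Complexification E) :=
  inferInstanceAs (IsTopologicalAddGroup (E × E))

instance [IsTopologicalAddGroup E] [ContinuousSMul ℝ E] :
    ContinuousSMul ℂ (Complexification E) where
  continuous_smul := by
    have : Continuous fun p : ℂ × (E × E) =>
        ((p.1.re • p.2.1 - p.1.im • p.2.2, p.1.re • p.2.2 + p.1.im • p.2.1) : E × E) := by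
      fun_prop
    exact this

end TopologicalVectorSpace

end Complexification

/-- The complexification of a real Hilbert space `H` as a complex Hilbert space: the `ℓ²`-sum of two
copies of `H`, where `(x, y)` stands for `x + i y`. -/
def HilbertComplexification (H : Type*) : Type _ := WithLp 2 (H × H)

namespace HilbertComplexification

variable {H : Type*} [NormedAddCommGroup H]

noncomputable instance : NormedAddCommGroup (HilbertComplexification H) :=
  inferInstanceAs (NormedAddCommGroup (WithLp 2 (H × H)))

instance [CompleteSpace H] : CompleteSpace (HilbertComplexification H) :=
  inferInstanceAs (CompleteSpace (WithLp 2 (H × H)))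

/-- The identity map, from the Hilbert space to the topological vector space complexification. -/
def toComplexification : HilbertComplexification H ≃+ Complexification H where
  toFun p := (WithLp.ofLp p : H × H)
  invFun p := WithLp.toLp 2 (p : H × H)
  map_add' _ _ := rfl

theorem norm_sq (p : HilbertComplexification H) :
    ‖p‖ ^ 2 = ‖(toComplexification p).1‖ ^ 2 + ‖(toComplexification p).2‖ ^ 2 :=
  WithLp.prod_norm_sq_eq_of_L2 (α := H) (β := H) p

theorem add_fst (p q : HilbertComplexification H) : (toComplexification (p + q)).1 =
    (toComplexification p).1 + (toComplexification q).1 := rfl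

theorem add_snd (p q : HilbertComplexification H) : (toComplexification (p + q)).2 =
    (toComplexification p).2 + (toComplexification q).2 := rfl

/-- The canonical embedding `x ↦ x + i 0` of `H` into its complexification. -/
noncomputable def ofReal (x : H) : HilbertComplexification H :=
  toComplexification.symm (Complexification.ofReal x)

theorem ofReal_fst (x : H) : (toComplexification (ofReal x)).1 = x := rfl

theorem ofReal_snd (x : H) : (toComplexification (ofReal x)).2 = 0 := rfl

variable [InnerProductSpace ℝ H]

noncomputable instance : SMul ℂ (HilbertComplexification H) where
  smul c p := toComplexification.symm (c • toComplexification p)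

noncomputable instance : Module ℂ (HilbertComplexification H) :=
  Function.Injective.module ℂ (toComplexification (H := H)).toAddMonoidHom
    (toComplexification (H := H)).injective fun _ _ => rfl

/-- The sesquilinear extension of the inner product of `H`, conjugate linear in the first
variable. -/
noncomputable instance : Inner ℂ (HilbertComplexification H) where
  inner p q :=
    ⟨inner ℝ (toComplexification p).1 (toComplexification q).1
        + inner ℝ (toComplexification p).2 (toComplexification q).2,
      inner ℝ (toComplexification p).1 (toComplexification q).2
        - inner ℝ (toComplexification p).2 (toComplexification q).1⟩

theorem inner_def (p q : HilbertComplexification H) :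
    inner ℂ p q = (⟨inner ℝ (toComplexification p).1 (toComplexification q).1
        + inner ℝ (toComplexification p).2 (toComplexification q).2,
      inner ℝ (toComplexification p).1 (toComplexification q).2
        - inner ℝ (toComplexification p).2 (toComplexification q).1⟩ : ℂ) := rfl

theorem smul_fst (c : ℂ) (p : HilbertComplexification H) : (toComplexification (c • p)).1 =
    c.re • (toComplexification p).1 - c.im • (toComplexification p).2 := rfl

theorem smul_snd (c : ℂ) (p : HilbertComplexification H) : (toComplexification (c • p)).2 =
    c.re • (toComplexification p).2 + c.im • (toComplexification p).1 := rfl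

noncomputable instance : InnerProductSpace ℂ (HilbertComplexification H) where
  norm_smul_le c p := by
    refine le_of_eq ((sq_eq_sq₀ (norm_nonneg _) (by positivity)).1 ?_)
    rw [mul_pow, norm_sq, norm_sq, Complex.sq_norm, Complex.normSq_apply, smul_fst, smul_snd,
      norm_sub_sq_real, norm_add_sq_real]
    simp only [norm_smul, mul_pow, real_inner_smul_left, real_inner_smul_right, Real.norm_eq_abs,
      sq_abs, real_inner_comm (toComplexification p).1 (toComplexification p).2]
    ring
  norm_sq_eq_re_inner p := by
    rw [norm_sq, inner_def]
    simp
  conj_inner_symm p q := by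
    rw [inner_def, inner_def]
    apply Complex.ext <;> simp [real_inner_comm]
  add_left p q r := by
    simp only [inner_def, add_fst, add_snd, inner_add_left]
    apply Complex.ext <;> simp <;> ring
  smul_left p q c := by
    simp only [inner_def, smul_fst, smul_snd, inner_add_left, inner_sub_left,
      real_inner_smul_left]
    apply Complex.ext <;> simp <;> ring

/-- The identity as a continuous complex linear map from the Hilbert space to the topological vector
space complexification. -/
noncomputable def toComplexificationCLM : HilbertComplexification H →L[ℂ] Complexification H where
  toFun := toComplexification
  map_add' := map_add _
  map_smul' _ _ := rfl
  cont := WithLp.prod_continuous_ofLp 2 H H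

theorem toComplexificationCLM_ofReal (x : H) :
    toComplexificationCLM (ofReal x) = Complexification.ofReal x := rfl

theorem inner_ofReal (x y : H) : inner ℂ (ofReal x) (ofReal y) = ((inner ℝ x y : ℝ) : ℂ) := by
  rw [inner_def, ofReal_fst, ofReal_snd, ofReal_fst, ofReal_snd]
  apply Complex.ext <;> simp

end HilbertComplexification

/-! ### Holomorphic maps between topological vector spaces -/

section Holomorphic

variable {X X' Y Y' Z : Type*} [AddCommGroup X] [Module ℂ X] [TopologicalSpace X]
  [AddCommGroup X'] [Module ℂ X'] [TopologicalSpace X']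
  [AddCommGroup Y] [Module ℂ Y] [TopologicalSpace Y]
  [AddCommGroup Y'] [Module ℂ Y'] [TopologicalSpace Y']
  [AddCommGroup Z] [Module ℂ Z] [TopologicalSpace Z]

theorem ContinuousLinearMap.map_real_smul_complex (L : X →L[ℂ] Y) (t : ℝ) (x : X) :
    L (t • x) = t • L x := by
  rw [← Complex.coe_smul, ← Complex.coe_smul, map_smul]

theorem IsHolomorphicOn.mono {f : X → Y} {U V : Set X} (hf : IsHolomorphicOn f V) (h : U ⊆ V) :
    IsHolomorphicOn f U := by
  obtain ⟨hc, df, h1, h2, h3⟩ := hf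
  exact ⟨hc.mono h, df, fun x hx => h1 x (h hx), h2.mono (Set.prod_mono_left h),
    fun x hx => h3 x (h hx)⟩

theorem IsHolomorphicOn.clm_comp {f : X → Y} {V : Set X} (hf : IsHolomorphicOn f V)
    (L : Y →L[ℂ] Y') : IsHolomorphicOn (fun x => L (f x)) V := by
  obtain ⟨hc, df, h1, h2, h3⟩ := hf
  refine ⟨L.continuous.comp_continuousOn hc, fun x h => L (df x h), fun x hx h => ?_,
    L.continuous.comp_continuousOn h2, fun x hx => ⟨fun h k => ?_, fun c h => ?_⟩⟩
  · have := (L.continuous.tendsto _).comp (h1 x hx h)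
    refine this.congr fun t => ?_
    simp only [Function.comp, L.map_real_smul_complex, map_sub]
  · beta_reduce
    rw [(h3 x hx).map_add, map_add]
  · beta_reduce
    rw [(h3 x hx).map_smul, map_smul]

theorem IsHolomorphicOn.comp_add_clm [ContinuousAdd X] {f : X → Y} {V : Set X}
    (hf : IsHolomorphicOn f V) (a : X) (A : X' →L[ℂ] X) :
    IsHolomorphicOn (fun x => f (a + A x)) ((fun x => a + A x) ⁻¹' V) := by
  obtain ⟨hc, df, h1, h2, h3⟩ := hf
  refine ⟨hc.comp (by fun_prop) fun _ hx => hx, fun x h => df (a + A x) (A h),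
    fun x hx h => ?_, ?_, fun x hx => ⟨fun h k => ?_, fun c h => ?_⟩⟩
  · have := h1 (a + A x) hx (A h)
    unfold HasDirectionalDeriv at this ⊢
    simpa only [map_add, A.map_real_smul_complex, add_assoc] using this
  · refine h2.comp (f := fun p : X' × X' => (a + A p.1, A p.2)) (by fun_prop) fun p hp => ?_
    exact ⟨hp.1, trivial⟩
  · beta_reduce
    rw [map_add, (h3 _ hx).map_add]
  · beta_reduce
    rw [map_smul, (h3 _ hx).map_smul]

theorem IsHolomorphicOn.comp_clm [ContinuousAdd X] {f : X → Y} {V : Set X}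
    (hf : IsHolomorphicOn f V) (A : X' →L[ℂ] X) : IsHolomorphicOn (fun x => f (A x)) (A ⁻¹' V) := by
  simpa only [zero_add] using hf.comp_add_clm 0 A

theorem tendsto_add_real_smul [IsTopologicalAddGroup X] [ContinuousSMul ℂ X] (x h : X) :
    Tendsto (fun t : ℝ => x + t • h) (𝓝[≠] 0) (𝓝 x) := by
  have : Continuous fun t : ℝ => x + (t : ℂ) • h := by fun_prop
  simpa using (this.tendsto 0).mono_left nhdsWithin_le_nhds

theorem IsHolomorphicOn.congr [IsTopologicalAddGroup X] [ContinuousSMul ℂ X] {f g : X → Y}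
    {V : Set X} (hV : IsOpen V) (hf : IsHolomorphicOn f V) (hfg : ∀ x ∈ V, f x = g x) :
    IsHolomorphicOn g V := by
  obtain ⟨hc, df, h1, h2, h3⟩ := hf
  refine ⟨hc.congr fun x hx => (hfg x hx).symm, df, fun x hx h => ?_, h2, h3⟩
  refine (h1 x hx h).congr' ?_
  filter_upwards [(tendsto_add_real_smul x h).eventually_mem (hV.mem_nhds hx)] with t ht
  rw [hfg _ ht, hfg x hx]

/-- Product rule for a jointly continuous complex bilinear map. -/
theorem IsHolomorphicOn.bilinear [IsTopologicalAddGroup X] [ContinuousSMul ℂ X]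
    [ContinuousAdd Z] {f : X → Y} {g : X → Y'} {V : Set X} (hV : IsOpen V)
    (hf : IsHolomorphicOn f V) (hg : IsHolomorphicOn g V) (B : Y →ₗ[ℂ] Y' →ₗ[ℂ] Z)
    (hB : Continuous fun p : Y × Y' => B p.1 p.2) :
    IsHolomorphicOn (fun x => B (f x) (g x)) V := by
  obtain ⟨hfc, df, f1, f2, f3⟩ := hf
  obtain ⟨hgc, dg, g1, g2, g3⟩ := hg
  have hfst : ContinuousOn (fun p : X × X => p.1) (V ×ˢ (Set.univ : Set X)) := continuousOn_fst
  have hm : Set.MapsTo (fun p : X × X => p.1) (V ×ˢ (Set.univ : Set X)) V := fun p hp => hp.1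
  refine ⟨hB.comp_continuousOn (hfc.prodMk hgc),
    fun x h => B (df x h) (g x) + B (f x) (dg x h), fun x hx h => ?_,
    (hB.comp_continuousOn (f2.prodMk (hgc.comp hfst hm))).add
      (hB.comp_continuousOn ((hfc.comp hfst hm).prodMk g2)),
    fun x hx => ⟨fun h k => ?_, fun c h => ?_⟩⟩
  · have hgx : Tendsto (fun t : ℝ => g (x + t • h)) (𝓝[≠] 0) (𝓝 (g x)) :=
      (hgc.continuousAt (hV.mem_nhds hx)).tendsto.comp (tendsto_add_real_smul x h)
    have t1 := (hB.tendsto (df x h, g x)).comp ((f1 x hx h).prodMk_nhds hgx)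
    have t2 := (hB.tendsto (f x, dg x h)).comp ((tendsto_const_nhds (x := f x)).prodMk_nhds
      (g1 x hx h))
    refine (t1.add t2).congr fun t => ?_
    simp only [Function.comp, ← Complex.coe_smul, map_smul, map_sub, LinearMap.smul_apply,
      LinearMap.sub_apply, smul_sub]
    abel
  · beta_reduce
    rw [(f3 x hx).map_add, (g3 x hx).map_add, map_add, map_add, LinearMap.add_apply]
    abel
  · beta_reduce
    rw [(f3 x hx).map_smul, (g3 x hx).map_smul, map_smul, map_smul, LinearMap.smul_apply,
      smul_add]

end Holomorphic

section Lines

variable {X Y : Type*} [AddCommGroup X] [Module ℂ X] [NormedAddCommGroup Y] [NormedSpace ℂ Y]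

/-- Differentiability along a complex line at any of its points can be checked after moving the base
point there. -/
theorem differentiableAt_line_of_shift {f : X → Y} {z h : X} {l : ℂ}
    (hf : DifferentiableAt ℂ (fun m : ℂ => f (z + l • h + m • h)) 0) :
    DifferentiableAt ℂ (fun m : ℂ => f (z + m • h)) l := by
  have := hf.hasDerivAt
  rw [← sub_self l] at this
  refine (this.comp_sub_const l l).differentiableAt.congr_of_eventuallyEq
    (Eventually.of_forall fun m => ?_)
  beta_reduce
  rw [sub_smul]
  congr 1
  abel

theorem hasDirectionalDeriv_of_hasDerivAt {f : X → Y} {z h : X} {d : Y}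
    (hf : HasDerivAt (fun l : ℂ => f (z + l • h)) d 0) : HasDirectionalDeriv f z h d := by
  have h1 : HasDerivAt (fun t : ℝ => f (z + (t : ℂ) • h)) d 0 := by
    have := HasDerivAt.scomp (h := fun t : ℝ => (t : ℂ)) (h' := 1) (0 : ℝ)
      (by simpa using hf) Complex.ofRealCLM.hasDerivAt
    simpa [Function.comp_def] using this
  rw [hasDerivAt_iff_tendsto_slope_zero] at h1
  refine h1.congr fun t => ?_
  simp [Complex.coe_smul]

theorem hasDerivAt_of_hasDirectionalDeriv {f : X → Y} {z h : X} {d : Y}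
    (t : ℝ) (hf : HasDirectionalDeriv f (z + t • h) h d) :
    HasDerivAt (fun t : ℝ => f (z + t • h)) d t := by
  rw [hasDerivAt_iff_tendsto_slope_zero]
  refine hf.congr fun s => ?_
  rw [add_smul, add_assoc]

variable [TopologicalSpace X] [IsTopologicalAddGroup X] [ContinuousSMul ℂ X]

/-- Along complex lines, a holomorphic map is complex differentiable in the usual sense. The
directional derivatives along real multiples of `η • h` control the increment of
`l ↦ f (z + l • h)` from `0` to `η` by the mean value inequality. -/
theorem hasDerivAt_line {f : X → Y} {V : Set X} (hV : IsOpen V) {df : X → X → Y}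
    (h1 : ∀ x ∈ V, ∀ h : X, HasDirectionalDeriv f x h (df x h))
    (h2 : ContinuousOn (fun p : X × X => df p.1 p.2) (V ×ˢ Set.univ))
    (h3 : ∀ x ∈ V, IsLinearMap ℂ (df x)) {z : X} (hz : z ∈ V) (h : X) :
    HasDerivAt (fun l : ℂ => f (z + l • h)) (df z h) 0 := by
  rw [hasDerivAt_iff_isLittleO_nhds_zero, Asymptotics.isLittleO_iff]
  intro ε hε
  have hline : Continuous fun l : ℂ => z + l • h := by fun_prop
  have hcont : ContinuousAt (fun l : ℂ => df (z + l • h) h) 0 := by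
    have hat : ContinuousAt (fun p : X × X => df p.1 p.2) (z + (0 : ℂ) • h, h) :=
      h2.continuousAt ((hV.prod isOpen_univ).mem_nhds ⟨by simpa using hz, trivial⟩)
    exact ContinuousAt.comp (f := fun l : ℂ => (z + l • h, h)) hat (by fun_prop)
  have e1 : ∀ᶠ l : ℂ in 𝓝 0, z + l • h ∈ V :=
    hline.continuousAt.eventually_mem (hV.mem_nhds (by simpa using hz))
  have e2 : ∀ᶠ l : ℂ in 𝓝 0, ‖df (z + l • h) h - df z h‖ ≤ ε := by
    have := hcont.eventually (closedBall_mem_nhds _ hε)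
    simpa [mem_closedBall, dist_eq_norm] using this
  obtain ⟨δ, hδ, hball⟩ := Metric.eventually_nhds_iff_ball.1 (e1.and e2)
  filter_upwards [ball_mem_nhds (0 : ℂ) hδ] with η hη
  have hmem : ∀ t ∈ Set.Icc (0 : ℝ) 1, (t : ℂ) * η ∈ ball (0 : ℂ) δ := by
    intro t ht
    rw [mem_ball_zero_iff] at hη ⊢
    rw [norm_mul, Complex.norm_real, Real.norm_of_nonneg ht.1]
    nlinarith [ht.2, norm_nonneg η]
  have hpt : ∀ t : ℝ, z + t • (η • h) = z + ((t : ℂ) * η) • h := fun t => by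
    rw [← Complex.coe_smul, smul_smul]
  have hder : ∀ t ∈ Set.Icc (0 : ℝ) 1, HasDerivWithinAt
      (fun t : ℝ => f (z + t • (η • h)) - t • (η • df z h))
      (η • (df (z + ((t : ℂ) * η) • h) h - df z h)) (Set.Icc 0 1) t := by
    intro t ht
    have hV' : z + t • (η • h) ∈ V := by
      rw [hpt]
      exact (hball _ (hmem t ht)).1
    have := (hasDerivAt_of_hasDirectionalDeriv t (h1 _ hV' (η • h))).sub
      ((hasDerivAt_id t).smul_const (η • df z h))
    rw [(h3 _ hV').map_smul, hpt, one_smul, ← smul_sub] at this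
    exact this.hasDerivWithinAt
  have := norm_image_sub_le_of_norm_deriv_le_segment_01' (C := ε * ‖η‖) hder fun t ht => by
    rw [norm_smul, mul_comm]
    exact mul_le_mul_of_nonneg_right (hball _ (hmem t ⟨ht.1, ht.2.le⟩)).2 (norm_nonneg _)
  refine le_trans (le_of_eq ?_) this
  congr 1
  simp only [one_smul, zero_smul, add_zero, sub_zero, zero_add]
  abel

theorem IsHolomorphicOn.differentiableAt_line {f : X → Y} {V : Set X} (hV : IsOpen V)
    (hf : IsHolomorphicOn f V) (z h : X) (l : ℂ) (hl : z + l • h ∈ V) :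
    DifferentiableAt ℂ (fun l : ℂ => f (z + l • h)) l := by
  obtain ⟨-, df, h1, h2, h3⟩ := hf
  exact differentiableAt_line_of_shift (hasDerivAt_line hV h1 h2 h3 hl h).differentiableAt

theorem isLinearMap_deriv_line {f : X → Y} {V : Set X} (hV : IsOpen V)
    (hf : IsHolomorphicOn f V) {z : X} (hz : z ∈ V) :
    IsLinearMap ℂ fun h => deriv (fun l : ℂ => f (z + l • h)) 0 := by
  obtain ⟨-, df, h1, h2, h3⟩ := hf
  have : (fun h => deriv (fun l : ℂ => f (z + l • h)) 0) = df z :=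
    funext fun h => (hasDerivAt_line hV h1 h2 h3 hz h).deriv
  rw [this]
  exact h3 z hz

theorem exists_closedBall_line_mem {V : Set X} (hV : IsOpen V) {z : X} (hz : z ∈ V)
    (h : X) : ∃ r > 0, ∀ l ∈ closedBall (0 : ℂ) r, z + l • h ∈ V := by
  have hline : Continuous fun l : ℂ => z + l • h := by fun_prop
  have : ∀ᶠ l : ℂ in 𝓝 0, z + l • h ∈ V :=
    hline.continuousAt.eventually_mem (hV.mem_nhds (by simpa using hz))
  exact Metric.nhds_basis_closedBall.eventually_iff.1 this

/-- A continuous map is holomorphic if it is complex differentiable along complex lines and its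
derivative is linear: the joint continuity of the derivative comes from the Cauchy estimate,
applied to the difference of the restrictions to two nearby lines. -/
theorem isHolomorphicOn_of_differentiableAt_line {f : X → Y} {V : Set X} (hV : IsOpen V)
    (hc : ContinuousOn f V)
    (hd : ∀ z ∈ V, ∀ h, DifferentiableAt ℂ (fun l : ℂ => f (z + l • h)) 0)
    (hlin : ∀ z ∈ V, IsLinearMap ℂ fun h => deriv (fun l : ℂ => f (z + l • h)) 0) :
    IsHolomorphicOn f V := by
  refine ⟨hc, fun z h => deriv (fun l : ℂ => f (z + l • h)) 0,
    fun z hz h => hasDirectionalDeriv_of_hasDerivAt (hd z hz h).hasDerivAt, ?_, hlin⟩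
  have hd' : ∀ z h : X, ∀ l : ℂ, z + l • h ∈ V →
      DifferentiableAt ℂ (fun l : ℂ => f (z + l • h)) l :=
    fun z h l hl => differentiableAt_line_of_shift (hd _ hl h)
  rintro ⟨z₀, h₀⟩ ⟨hz₀, -⟩
  refine ContinuousAt.continuousWithinAt ?_
  obtain ⟨r, hr, hball⟩ := exists_closedBall_line_mem hV hz₀ h₀
  rw [ContinuousAt, Metric.tendsto_nhds]
  intro ε hε
  have hev : ∀ᶠ p : X × X in 𝓝 (z₀, h₀), ∀ l ∈ closedBall (0 : ℂ) r, p.1 + l • p.2 ∈ V ∧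
      ‖f (p.1 + l • p.2) - f (z₀ + l • h₀)‖ < ε / 2 * r := by
    refine (isCompact_closedBall (0 : ℂ) r).eventually_forall_of_forall_eventually
      (P := fun (p : X × X) (l : ℂ) => p.1 + l • p.2 ∈ V ∧
        ‖f (p.1 + l • p.2) - f (z₀ + l • h₀)‖ < ε / 2 * r) fun l hl => ?_
    have hl' := hball l hl
    have c1 : Continuous fun q : (X × X) × ℂ => q.1.1 + q.2 • q.1.2 := by fun_prop
    have c2 : Continuous fun q : (X × X) × ℂ => z₀ + q.2 • h₀ := by fun_prop
    have hfl : ContinuousAt f (z₀ + l • h₀) := hc.continuousAt (hV.mem_nhds hl')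
    have d1 : ContinuousAt (fun q : (X × X) × ℂ => f (q.1.1 + q.2 • q.1.2)) ((z₀, h₀), l) :=
      ContinuousAt.comp (f := fun q : (X × X) × ℂ => q.1.1 + q.2 • q.1.2) hfl c1.continuousAt
    have d2 : ContinuousAt (fun q : (X × X) × ℂ => f (z₀ + q.2 • h₀)) ((z₀, h₀), l) :=
      ContinuousAt.comp (f := fun q : (X × X) × ℂ => z₀ + q.2 • h₀) hfl c2.continuousAt
    have d3 := (d1.sub d2).norm
    refine (c1.continuousAt.eventually_mem (hV.mem_nhds hl')).and
      (d3.eventually_lt continuousAt_const ?_)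
    rw [Pi.sub_apply, sub_self, norm_zero]
    positivity
  filter_upwards [hev] with p hp
  have s1 : ∀ z h : X, (∀ l ∈ closedBall (0 : ℂ) r, z + l • h ∈ V) →
      DiffContOnCl ℂ (fun l : ℂ => f (z + l • h)) (ball 0 r) := fun z h hzh =>
    DifferentiableOn.diffContOnCl fun l hl =>
      (hd' z h l (hzh l (closure_ball_subset_closedBall hl))).differentiableWithinAt
  have hp' : ∀ l ∈ closedBall (0 : ℂ) r, p.1 + l • p.2 ∈ V := fun l hl => (hp l hl).1
  have := Complex.norm_deriv_le_of_forall_mem_sphere_norm_le hr ((s1 _ _ hp').sub (s1 _ _ hball))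
    fun l hl => (hp l (sphere_subset_closedBall hl)).2.le
  have h0 : (0 : ℂ) ∈ closedBall (0 : ℂ) r := by simpa using hr.le
  rw [deriv_sub (hd' _ _ _ (hp' 0 h0)) (hd' _ _ _ (hball 0 h0)), mul_div_cancel_right₀ _ hr.ne']
    at this
  rw [dist_eq_norm]
  exact this.trans_lt (half_lt_self hε)

end Lines

/-! ### Maps into a Hilbert space determined by their kernel -/

section Hilbert

variable {K : Type*} [NormedAddCommGroup K] [InnerProductSpace ℂ K]

/-- A sequence whose Gram matrix converges is Cauchy, since
`‖u n - u m‖² = ‖u n‖² - 2 re ⟪u n, u m⟫ + ‖u m‖²`. -/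
theorem cauchySeq_of_tendsto_inner {u : ℕ → K} {L : ℂ}
    (h : Tendsto (fun p : ℕ × ℕ => inner ℂ (u p.1) (u p.2)) (atTop ×ˢ atTop) (𝓝 L)) :
    CauchySeq u := by
  have hre : Tendsto (fun p : ℕ × ℕ => RCLike.re (inner ℂ (u p.1) (u p.2))) (atTop ×ˢ atTop)
      (𝓝 (RCLike.re L)) := (RCLike.continuous_re.tendsto L).comp h
  have hn : Tendsto (fun n => ‖u n‖ ^ 2) atTop (𝓝 (RCLike.re L)) := by
    refine (hre.comp (tendsto_id.prodMk tendsto_id)).congr fun n => ?_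
    exact (norm_sq_eq_re_inner (𝕜 := ℂ) (u n)).symm
  rw [cauchySeq_iff_tendsto_dist_atTop_0, ← prod_atTop_atTop_eq]
  have h2 := ((hn.comp (tendsto_fst (g := atTop (α := ℕ)))).sub (hre.const_mul 2)).add
    (hn.comp (tendsto_snd (f := atTop (α := ℕ))))
  have h3 : Tendsto (fun p : ℕ × ℕ => ‖u p.1 - u p.2‖ ^ 2) (atTop ×ˢ atTop) (𝓝 0) := by
    have e : RCLike.re L - 2 * RCLike.re L + RCLike.re L = 0 := by ring
    rw [e] at h2
    exact h2.congr fun p => (norm_sub_sq (𝕜 := ℂ) (u p.1) (u p.2)).symm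
  have h4 := h3.sqrt
  simpa [dist_eq_norm] using h4

theorem continuousOn_of_inner_eq {X : Type*} [TopologicalSpace X] {F : X → K} {V : Set X}
    {k : X × X → ℂ} (hk : ContinuousOn k (V ×ˢ V))
    (hF : ∀ w ∈ V, ∀ z ∈ V, inner ℂ (F w) (F z) = k (w, z)) : ContinuousOn F V := by
  intro z₀ hz₀
  rw [ContinuousWithinAt, tendsto_iff_norm_sub_tendsto_zero]
  have hz : ∀ᶠ z in 𝓝[V] z₀, z ∈ V := eventually_mem_nhdsWithin
  have hid : Tendsto (fun z : X => z) (𝓝[V] z₀) (𝓝 z₀) := nhdsWithin_le_nhds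
  have hk0 : Tendsto k (𝓝[V ×ˢ V] (z₀, z₀)) (𝓝 (k (z₀, z₀))) := hk _ ⟨hz₀, hz₀⟩
  have t1 : Tendsto (fun z => k (z, z)) (𝓝[V] z₀) (𝓝 (k (z₀, z₀))) := by
    refine hk0.comp (tendsto_nhdsWithin_iff.2 ⟨hid.prodMk_nhds hid, hz.mono fun z h => ⟨h, h⟩⟩)
  have t2 : Tendsto (fun z => k (z, z₀)) (𝓝[V] z₀) (𝓝 (k (z₀, z₀))) := by
    refine hk0.comp (tendsto_nhdsWithin_iff.2
      ⟨hid.prodMk_nhds tendsto_const_nhds, hz.mono fun z h => ⟨h, hz₀⟩⟩)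
  have r : Continuous fun c : ℂ => RCLike.re c := RCLike.continuous_re
  have h2 := (((r.tendsto _).comp t1).sub (((r.tendsto _).comp t2).const_mul 2)).add
    (tendsto_const_nhds (x := RCLike.re (k (z₀, z₀))))
  have e : RCLike.re (k (z₀, z₀)) - 2 * RCLike.re (k (z₀, z₀)) + RCLike.re (k (z₀, z₀)) = 0 := by
    ring
  rw [e] at h2
  have h3 : Tendsto (fun z => ‖F z - F z₀‖ ^ 2) (𝓝[V] z₀) (𝓝 0) := by
    refine h2.congr' (hz.mono fun z h => ?_)
    beta_reduce
    rw [norm_sub_sq (𝕜 := ℂ), norm_sq_eq_re_inner (𝕜 := ℂ) (F z),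
      norm_sq_eq_re_inner (𝕜 := ℂ) (F z₀), hF z h z h, hF z h z₀ hz₀, hF z₀ hz₀ z₀ hz₀]
    rfl
  simpa using h3.sqrt

theorem inner_circleIntegral [CompleteSpace K] {g : ℂ → K} {c : ℂ} {R : ℝ}
    (hg : CircleIntegrable g c R) (v : K) :
    inner ℂ v (∮ z in C(c, R), g z) = ∮ z in C(c, R), inner ℂ v (g z) := by
  rw [circleIntegral, circleIntegral, ← innerSL_apply_apply ℂ v,
    ← ContinuousLinearMap.intervalIntegral_comp_comm _ hg.out]
  simp

/-- A continuous curve on a disc is complex differentiable at the centre if its inner products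
with the elements of a set containing all its values are holomorphic. Its Cauchy integral `ψ` has
the same inner products with that set, so `ψ w - φ w` is orthogonal to the values of `φ`, hence to
`ψ w` too. -/
theorem differentiableAt_of_inner_self [CompleteSpace K] {φ : ℂ → K} {r : ℝ} (hr : 0 < r)
    {s : Set K} (hφs : ∀ l ∈ closedBall (0 : ℂ) r, φ l ∈ s)
    (hc : ContinuousOn φ (closedBall 0 r))
    (hd : ∀ v ∈ s, DifferentiableOn ℂ (fun l => inner ℂ v (φ l)) (closedBall 0 r)) :
    DifferentiableAt ℂ φ 0 := by
  have hint : CircleIntegrable φ 0 r :=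
    (hc.mono sphere_subset_closedBall).circleIntegrable hr.le
  set ψ : ℂ → K := fun w => (2 * Real.pi * Complex.I)⁻¹ • ∮ z in C(0, r), (z - w)⁻¹ • φ z with hψ
  have hψd : DifferentiableAt ℂ ψ 0 := by
    have := hasFPowerSeriesOn_cauchy_integral (f := φ) (c := 0) (R := ⟨r, hr.le⟩) hint hr
    exact this.analyticAt.differentiableAt
  have hinner : ∀ v : K, DifferentiableOn ℂ (fun l => inner ℂ v (φ l)) (closedBall 0 r) →
      ∀ w ∈ ball (0 : ℂ) r, inner ℂ v (ψ w) = inner ℂ v (φ w) := by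
    intro v hv w hw
    have hcl : DiffContOnCl ℂ (fun l => inner ℂ v (φ l)) (ball 0 r) :=
      DifferentiableOn.diffContOnCl (by rwa [closure_ball _ hr.ne'])
    have hint' : CircleIntegrable (fun z => (z - w)⁻¹ • φ z) 0 r := by
      refine ContinuousOn.circleIntegrable hr.le (ContinuousOn.smul (ContinuousOn.inv₀
        (continuousOn_id.sub continuousOn_const) fun z hz h0 => ?_)
        (hc.mono sphere_subset_closedBall))
      have : z = w := sub_eq_zero.1 h0
      rw [mem_sphere_zero_iff_norm, this] at hz
      rw [mem_ball_zero_iff] at hw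
      exact hw.ne hz
    rw [hψ, inner_smul_right, inner_circleIntegral hint']
    simp only [inner_smul_right]
    have := hcl.circleIntegral_sub_inv_smul hw
    simp only [smul_eq_mul] at this
    rw [this, ← mul_assoc, inv_mul_cancel₀ Complex.two_pi_I_ne_zero, one_mul]
  have heq : ∀ w ∈ ball (0 : ℂ) r, φ w = ψ w := by
    intro w hw
    set d := ψ w - φ w with hdd
    have h1 : ∀ v ∈ s, inner ℂ d v = 0 := fun v hv => by
      rw [← inner_conj_symm, hdd, inner_sub_right, hinner v (hd v hv) w hw, sub_self, map_zero]
    have h2 : inner ℂ d (ψ w) = inner ℂ d (φ w) := by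
      refine hinner d ((differentiableOn_const (0 : ℂ)).congr fun l hl => ?_) w hw
      exact h1 _ (hφs l hl)
    have h3 : inner ℂ d d = 0 := by
      conv_lhs => rw [hdd]
      rw [inner_sub_right, h2, sub_self]
    exact (sub_eq_zero.1 (inner_self_eq_zero.1 h3)).symm
  exact hψd.congr_of_eventuallyEq (eventually_of_mem (ball_mem_nhds _ hr) heq)

variable {X : Type*} [AddCommGroup X] [Module ℂ X] [TopologicalSpace X]
  [IsTopologicalAddGroup X] [ContinuousSMul ℂ X]

/-- A continuous map `F` is holomorphic if its inner products with its own values are. -/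
theorem isHolomorphicOn_of_inner [CompleteSpace K] {F : X → K} {V : Set X} (hV : IsOpen V)
    (hc : ContinuousOn F V)
    (hk : ∀ w ∈ V, IsHolomorphicOn (fun z => inner ℂ (F w) (F z)) V) : IsHolomorphicOn F V := by
  have hd : ∀ z ∈ V, ∀ h, DifferentiableAt ℂ (fun l : ℂ => F (z + l • h)) 0 := by
    intro z hz h
    obtain ⟨r, hr, hball⟩ := exists_closedBall_line_mem hV hz h
    refine differentiableAt_of_inner_self hr (s := F '' V)
      (fun l hl => Set.mem_image_of_mem _ (hball l hl))
      (hc.comp (by fun_prop) hball) ?_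
    rintro _ ⟨w, hw, rfl⟩ l hl
    exact ((hk w hw).differentiableAt_line hV z h l (hball l hl)).differentiableWithinAt
  have hder : ∀ z ∈ V, ∀ h v, HasDerivAt (fun l : ℂ => inner ℂ v (F (z + l • h)))
      (inner ℂ v (deriv (fun l : ℂ => F (z + l • h)) 0)) 0 := fun z hz h v =>
    (innerSL ℂ v).hasFDerivAt.comp_hasDerivAt (0 : ℂ) (hd z hz h).hasDerivAt
  -- A vector orthogonal to all values of `F` is orthogonal to all derivatives of `F`.
  have horth : ∀ z ∈ V, ∀ d : K, (∀ w ∈ V, inner ℂ (F w) d = 0) → ∀ h,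
      inner ℂ d (deriv (fun l : ℂ => F (z + l • h)) 0) = 0 := by
    intro z hz d hdF h
    obtain ⟨r, hr, hball⟩ := exists_closedBall_line_mem hV hz h
    refine (hder z hz h d).unique ((hasDerivAt_const (0 : ℂ) (0 : ℂ)).congr_of_eventuallyEq ?_)
    filter_upwards [closedBall_mem_nhds (0 : ℂ) hr] with l hl
    rw [← inner_conj_symm, hdF _ (hball l hl), map_zero]
  have hlin : ∀ z ∈ V, ∀ w ∈ V,
      IsLinearMap ℂ fun h => inner ℂ (F w) (deriv (fun l : ℂ => F (z + l • h)) 0) := by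
    intro z hz w hw
    have := isLinearMap_deriv_line hV (hk w hw) hz
    simpa only [(hder z hz _ (F w)).deriv] using this
  refine isHolomorphicOn_of_differentiableAt_line hV hc hd fun z hz =>
    ⟨fun h k => ?_, fun c h => ?_⟩
  · set d := deriv (fun l : ℂ => F (z + l • (h + k))) 0 - (deriv (fun l : ℂ => F (z + l • h)) 0
      + deriv (fun l : ℂ => F (z + l • k)) 0) with hdd
    have h1 : ∀ w ∈ V, inner ℂ (F w) d = 0 := fun w hw => by
      rw [hdd, inner_sub_right, inner_add_right, (hlin z hz w hw).map_add, sub_self]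
    refine sub_eq_zero.1 (inner_self_eq_zero (𝕜 := ℂ).1 ?_)
    change inner ℂ d d = 0
    conv_lhs => rw [hdd]
    rw [inner_sub_right, inner_add_right, horth z hz d h1, horth z hz d h1, horth z hz d h1]
    simp
  · set d := deriv (fun l : ℂ => F (z + l • (c • h))) 0
      - c • deriv (fun l : ℂ => F (z + l • h)) 0 with hdd
    have h1 : ∀ w ∈ V, inner ℂ (F w) d = 0 := fun w hw => by
      rw [hdd, inner_sub_right, inner_smul_right, (hlin z hz w hw).map_smul, smul_eq_mul, sub_self]
    refine sub_eq_zero.1 (inner_self_eq_zero (𝕜 := ℂ).1 ?_)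
    change inner ℂ d d = 0
    conv_lhs => rw [hdd]
    rw [inner_sub_right, inner_smul_right, horth z hz d h1, horth z hz d h1]
    simp

end Hilbert

/-! ### Complexification of linear and bilinear maps -/

namespace Complexification

theorem continuous_ofReal {E : Type*} [AddCommGroup E] [TopologicalSpace E] :
    Continuous (ofReal : E → Complexification E) := by
  have : Continuous fun x : E => ((x, 0) : E × E) := by fun_prop
  exact this

variable {E E' : Type*} [AddCommGroup E] [Module ℝ E] [AddCommGroup E'] [Module ℝ E']

/-- The point `x + s y` for `z = x + i y` and a complex parameter `s`. It is `z` at `s = i` and the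
conjugate of `z` at `s = -i`. -/
def line (z : Complexification E) (s : ℂ) : Complexification E := ofReal z.1 + s • ofReal z.2

theorem line_I (z : Complexification E) : line z Complex.I = z := by
  change ((z.1 + ((Complex.I).re • z.2 - (Complex.I).im • (0 : E)),
    0 + ((Complex.I).re • (0 : E) + (Complex.I).im • z.2)) : E × E) = (z.1, z.2)
  simp

theorem line_coe (z : Complexification E) (s : ℝ) : line z s = ofReal (z.1 + s • z.2) := by
  change ((z.1 + ((s : ℂ).re • z.2 - (s : ℂ).im • (0 : E)),
    0 + ((s : ℂ).re • (0 : E) + (s : ℂ).im • z.2)) : E × E) = (z.1 + s • z.2, 0)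
  simp

theorem line_ofReal (x : E) (s : ℂ) : line (ofReal x) s = ofReal x := by
  change ofReal x + s • (0 : Complexification E) = ofReal x
  rw [smul_zero, add_zero]

variable [TopologicalSpace E] [TopologicalSpace E']

/-- The complex linear extension of a continuous real linear map. -/
def map (A : E →L[ℝ] E') : Complexification E →L[ℂ] Complexification E' where
  toFun z := ((A z.1, A z.2) : E' × E')
  map_add' z w := by
    change ((A (z.1 + w.1), A (z.2 + w.2)) : E' × E') = (A z.1 + A w.1, A z.2 + A w.2)
    rw [map_add, map_add]
  map_smul' c z := by
    change ((A (c.re • z.1 - c.im • z.2), A (c.re • z.2 + c.im • z.1)) : E' × E')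
      = (c.re • A z.1 - c.im • A z.2, c.re • A z.2 + c.im • A z.1)
    simp only [map_sub, map_add, map_smul]
  cont := by
    have : Continuous fun z : E × E => ((A z.1, A z.2) : E' × E') := by fun_prop
    exact this

theorem map_ofReal (A : E →L[ℝ] E') (x : E) : map A (ofReal x) = ofReal (A x) := by
  change ((A x, A 0) : E' × E') = (A x, 0)
  rw [map_zero]

/-- The complex linear extension of a continuous real linear functional, with values in `ℂ`. -/
noncomputable def extendRe (A : E →L[ℝ] ℝ) : Complexification E →L[ℂ] ℂ where
  toFun z := (A z.1 : ℂ) + A z.2 * Complex.I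
  map_add' z w := by
    change ((A (z.1 + w.1) : ℝ) : ℂ) + (A (z.2 + w.2) : ℝ) * Complex.I = _
    rw [map_add, map_add]
    push_cast
    ring
  map_smul' c z := by
    change ((A (c.re • z.1 - c.im • z.2) : ℝ) : ℂ)
      + (A (c.re • z.2 + c.im • z.1) : ℝ) * Complex.I = c * (A z.1 + A z.2 * Complex.I)
    simp only [map_sub, map_add, map_smul, smul_eq_mul]
    apply Complex.ext <;> simp
  cont := by
    have : Continuous fun z : E × E => (A z.1 : ℂ) + A z.2 * Complex.I := by fun_prop
    exact this

theorem extendRe_ofReal (A : E →L[ℝ] ℝ) (x : E) : extendRe A (ofReal x) = A x := by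
  change (A x : ℂ) + A 0 * Complex.I = A x
  simp

/-- The identification of the product of two complexifications with the complexification of the
product. -/
def prodMk : Complexification E × Complexification E' →L[ℂ] Complexification (E × E') where
  toFun p := (((p.1.1, p.2.1), (p.1.2, p.2.2)) : (E × E') × (E × E'))
  map_add' _ _ := rfl
  map_smul' _ _ := rfl
  cont := by
    have : Continuous fun p : (E × E) × (E' × E') =>
      (((p.1.1, p.2.1), (p.1.2, p.2.2)) : (E × E') × (E × E')) := by fun_prop
    exact this

theorem prodMk_ofReal (x : E) (y : E') :
    prodMk (ofReal x, ofReal y) = (ofReal (x, y) : Complexification (E × E')) := rfl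

theorem continuous_line [IsTopologicalAddGroup E] [ContinuousSMul ℝ E] :
    Continuous fun p : Complexification E × ℂ => line p.1 p.2 := by
  have h1 : Continuous fun z : Complexification E => (ofReal z.1 : Complexification E) :=
    continuous_ofReal.comp (continuous_fst (X := E) (Y := E))
  have h2 : Continuous fun z : Complexification E => (ofReal z.2 : Complexification E) :=
    continuous_ofReal.comp (continuous_snd (X := E) (Y := E))
  exact (h1.comp continuous_fst).add (continuous_snd.smul (h2.comp continuous_fst))

/-- The complex bilinear extension of a real bilinear map. -/
def map₂ {F F' L : Type*} [AddCommGroup F] [Module ℝ F] [AddCommGroup F'] [Module ℝ F']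
    [AddCommGroup L] [Module ℝ L] (B : F →ₗ[ℝ] F' →ₗ[ℝ] L) :
    Complexification F →ₗ[ℂ] Complexification F' →ₗ[ℂ] Complexification L :=
  LinearMap.mk₂ ℂ
    (fun z w => ((B z.1 w.1 - B z.2 w.2, B z.1 w.2 + B z.2 w.1) : L × L))
    (fun z z' w => by
      change ((B (z.1 + z'.1) w.1 - B (z.2 + z'.2) w.2,
        B (z.1 + z'.1) w.2 + B (z.2 + z'.2) w.1) : L × L) =
        ((B z.1 w.1 - B z.2 w.2) + (B z'.1 w.1 - B z'.2 w.2),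
          (B z.1 w.2 + B z.2 w.1) + (B z'.1 w.2 + B z'.2 w.1))
      simp only [map_add, LinearMap.add_apply, Prod.mk.injEq]
      constructor <;> abel)
    (fun c z w => by
      change ((B (c.re • z.1 - c.im • z.2) w.1 - B (c.re • z.2 + c.im • z.1) w.2,
        B (c.re • z.1 - c.im • z.2) w.2 + B (c.re • z.2 + c.im • z.1) w.1) : L × L) =
        (c.re • (B z.1 w.1 - B z.2 w.2) - c.im • (B z.1 w.2 + B z.2 w.1),
          c.re • (B z.1 w.2 + B z.2 w.1) + c.im • (B z.1 w.1 - B z.2 w.2))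
      simp only [map_add, map_sub, map_smul, LinearMap.add_apply, LinearMap.sub_apply,
        LinearMap.smul_apply, Prod.mk.injEq]
      constructor <;> module)
    (fun z w w' => by
      change ((B z.1 (w.1 + w'.1) - B z.2 (w.2 + w'.2),
        B z.1 (w.2 + w'.2) + B z.2 (w.1 + w'.1)) : L × L) =
        ((B z.1 w.1 - B z.2 w.2) + (B z.1 w'.1 - B z.2 w'.2),
          (B z.1 w.2 + B z.2 w.1) + (B z.1 w'.2 + B z.2 w'.1))
      simp only [map_add, Prod.mk.injEq]
      constructor <;> abel)
    (fun c z w => by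
      change ((B z.1 (c.re • w.1 - c.im • w.2) - B z.2 (c.re • w.2 + c.im • w.1),
        B z.1 (c.re • w.2 + c.im • w.1) + B z.2 (c.re • w.1 - c.im • w.2)) : L × L) =
        (c.re • (B z.1 w.1 - B z.2 w.2) - c.im • (B z.1 w.2 + B z.2 w.1),
          c.re • (B z.1 w.2 + B z.2 w.1) + c.im • (B z.1 w.1 - B z.2 w.2))
      simp only [map_add, map_sub, map_smul, Prod.mk.injEq]
      constructor <;> module)

theorem map₂_ofReal {F F' L : Type*} [AddCommGroup F] [Module ℝ F] [AddCommGroup F']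
    [Module ℝ F'] [AddCommGroup L] [Module ℝ L] (B : F →ₗ[ℝ] F' →ₗ[ℝ] L) (x : F) (y : F') :
    map₂ B (ofReal x) (ofReal y) = ofReal (B x y) := by
  change ((B x y - B 0 0, B x 0 + B 0 y) : L × L) = (B x y, 0)
  simp

theorem continuous_map₂ {F F' L : Type*} [AddCommGroup F] [Module ℝ F] [AddCommGroup F']
    [Module ℝ F'] [AddCommGroup L] [Module ℝ L] [TopologicalSpace F] [TopologicalSpace F']
    [TopologicalSpace L] [IsTopologicalAddGroup L] (B : F →ₗ[ℝ] F' →ₗ[ℝ] L)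
    (hB : Continuous fun p : F × F' => B p.1 p.2) :
    Continuous fun p : Complexification F × Complexification F' => map₂ B p.1 p.2 := by
  have h : ∀ {a : (F × F) × (F' × F') → F} {b : (F × F) × (F' × F') → F'}, Continuous a →
      Continuous b → Continuous fun p => B (a p) (b p) := fun ha hb => hB.comp (ha.prodMk hb)
  have : Continuous fun p : (F × F) × (F' × F') =>
      ((B p.1.1 p.2.1 - B p.1.2 p.2.2, B p.1.1 p.2.2 + B p.1.2 p.2.1) : L × L) :=
    ((h (by fun_prop) (by fun_prop)).sub (h (by fun_prop) (by fun_prop))).prodMk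
      ((h (by fun_prop) (by fun_prop)).add (h (by fun_prop) (by fun_prop)))
  exact this

end Complexification

/-! ### Holomorphic extension of a map from its kernel -/

section Kernel

open Complexification

variable {E : Type*} [AddCommGroup E] [Module ℝ E] [TopologicalSpace E]
  [IsTopologicalAddGroup E] [ContinuousSMul ℝ E]
  {H : Type*} [NormedAddCommGroup H] [InnerProductSpace ℝ H] [CompleteSpace H]

/-- If the kernel `⟨f x, f y⟩` extends to a bounded holomorphic function near `(x₀, x₀)`, then `f`
extends to a holomorphic map near `x₀`, the limit of the extrapolations of `f`. -/
theorem exists_holomorphic_feature_map {f : E → H} {x₀ : E} {Ω : Set (Complexification E)}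
    (hΩ : IsOpen Ω) (hx₀ : ofReal x₀ ∈ Ω) {k : Complexification E × Complexification E → ℂ}
    (hk : IsHolomorphicOn k (Ω ×ˢ Ω)) {C : ℝ} (hC : ∀ p ∈ Ω ×ˢ Ω, ‖k p‖ ≤ C)
    (hkf : ∀ x y, ofReal x ∈ Ω → ofReal y ∈ Ω →
      k (ofReal x, ofReal y) = ((inner ℝ (f x) (f y) : ℝ) : ℂ)) :
    ∃ V : Set (Complexification E), IsOpen V ∧ ofReal x₀ ∈ V ∧
      ∃ F : Complexification E → HilbertComplexification H, IsHolomorphicOn F V ∧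
        ∀ x, ofReal x ∈ V → F (ofReal x) = HilbertComplexification.ofReal (f x) := by
  obtain ⟨S, c, ε, hε, hS, hc⟩ := exists_interpolation_sequence
  -- `V` consists of the `x + i y` such that the disc `{x + s y | ‖s‖ ≤ 4}` is contained in `Ω`.
  set V : Set (Complexification E) :=
    interior {z | ∀ s ∈ closedBall (0 : ℂ) 4, line z s ∈ Ω} with hV
  have hVΩ : ∀ z ∈ V, ∀ s ∈ closedBall (0 : ℂ) 4, line z s ∈ Ω := fun z hz =>
    interior_subset hz
  have hx₀V : ofReal x₀ ∈ V := by
    rw [hV, mem_interior_iff_mem_nhds]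
    refine (isCompact_closedBall (0 : ℂ) 4).eventually_forall_of_forall_eventually
      (P := fun z s => line z s ∈ Ω) fun s hs => ?_
    refine continuous_line.continuousAt.eventually_mem (hΩ.mem_nhds ?_)
    simpa only [line_ofReal] using hx₀
  have hI : Complex.I ∈ closedBall (0 : ℂ) 4 := by simp
  have hI' : -Complex.I ∈ closedBall (0 : ℂ) 4 := by simp
  have hSm : ∀ n, ∀ s ∈ S n, (s : ℂ) ∈ closedBall (0 : ℂ) 4 := fun n s hs => by
    simpa using (hS n s hs).trans (by norm_num)
  set u : ℕ → Complexification E → HilbertComplexification H := fun n z =>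
    ∑ s ∈ S n, c n s • HilbertComplexification.ofReal (f (z.1 + s • z.2)) with hu
  have hinner : ∀ w ∈ V, ∀ z ∈ V, ∀ n m, inner ℂ (u n w) (u m z) =
      ∑ s ∈ S n, ∑ t ∈ S m, conj (c n s) * (c m t * k (line w s, line z t)) := by
    intro w hw z hz n m
    rw [hu]
    beta_reduce
    rw [sum_inner]
    refine Finset.sum_congr rfl fun s hs => ?_
    rw [inner_sum]
    refine Finset.sum_congr rfl fun t ht => ?_
    rw [inner_smul_left, inner_smul_right, HilbertComplexification.inner_ofReal]
    have h1 := hVΩ w hw s (hSm n s hs)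
    have h2 := hVΩ z hz t (hSm m t ht)
    rw [line_coe] at h1 h2
    rw [line_coe, line_coe, hkf _ _ h1 h2]
  have hlim : ∀ w ∈ V, ∀ z ∈ V, Tendsto (fun p : ℕ × ℕ => inner ℂ (u p.1 w) (u p.2 z))
      (atTop ×ˢ atTop) (𝓝 (k (line w (-Complex.I), z))) := by
    intro w hw z hz
    have := tendsto_double_interpolation hε hS hc (h := fun s t => k (line w s, line z t)) (C := C)
      (fun s hs t ht => ?_) (fun s hs t ht => ?_)
      fun s hs t ht => hC _ ⟨hVΩ w hw s hs, hVΩ z hz t ht⟩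
    · simp only [line_I] at this
      simpa only [hinner w hw z hz] using this
    · have := hk.differentiableAt_line (hΩ.prod hΩ) (ofReal w.1, line z t) (ofReal w.2, 0) s
        (by simpa using ⟨hVΩ w hw s hs, hVΩ z hz t ht⟩)
      simpa [line] using this
    · have := hk.differentiableAt_line (hΩ.prod hΩ) (line w s, ofReal z.1) (0, ofReal z.2) t
        (by simpa using ⟨hVΩ w hw s hs, hVΩ z hz t ht⟩)
      simpa [line] using this
  have hex : ∀ z ∈ V, ∃ y, Tendsto (fun n => u n z) atTop (𝓝 y) := fun z hz =>
    cauchySeq_tendsto_of_complete (cauchySeq_of_tendsto_inner (hlim z hz z hz))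
  choose! F hF using hex
  have hFk : ∀ w ∈ V, ∀ z ∈ V, inner ℂ (F w) (F z) = k (line w (-Complex.I), z) := by
    intro w hw z hz
    refine tendsto_nhds_unique (Filter.Tendsto.inner (𝕜 := ℂ) ?_ ?_) (hlim w hw z hz)
    · exact (hF w hw).comp tendsto_fst
    · exact (hF z hz).comp tendsto_snd
  have hconj : Continuous fun w : Complexification E => line w (-Complex.I) :=
    continuous_line.comp (continuous_id.prodMk continuous_const)
  have hFc : ContinuousOn F V := by
    refine continuousOn_of_inner_eq
      (k := fun p : Complexification E × Complexification E => k (line p.1 (-Complex.I), p.2))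
      ?_ hFk
    refine hk.1.comp ((hconj.comp continuous_fst).prodMk continuous_snd).continuousOn ?_
    rintro ⟨w, z⟩ ⟨hw, hz⟩
    exact ⟨hVΩ w hw _ hI', by simpa only [line_I] using hVΩ z hz _ hI⟩
  refine ⟨V, isOpen_interior, hx₀V, F, ?_, fun x hx => ?_⟩
  · refine isHolomorphicOn_of_inner isOpen_interior hFc fun w hw => ?_
    have := hk.comp_add_clm (line w (-Complex.I), 0)
      (ContinuousLinearMap.inr ℂ (Complexification E) (Complexification E))
    refine (this.mono fun z hz => ?_).congr isOpen_interior fun z hz => ?_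
    · simpa using ⟨hVΩ w hw _ hI', by simpa only [line_I] using hVΩ z hz _ hI⟩
    · simpa using (hFk w hw z hz).symm
  · -- At a real point all nodes give the value `f x`, and extrapolation reproduces constants.
    have hsum : Tendsto (fun n => ∑ s ∈ S n, c n s) atTop (𝓝 1) := by
      rw [tendsto_iff_norm_sub_tendsto_zero]
      refine squeeze_zero (fun _ => norm_nonneg _) (fun n => ?_) hε
      have := hc n (fun _ => 1) 1 (fun _ _ => differentiableAt_const _) (by simp)
      rw [norm_sub_rev]
      simpa using this
    have h1 := hsum.smul_const (HilbertComplexification.ofReal (f x))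
    rw [one_smul] at h1
    refine tendsto_nhds_unique (hF _ hx) (h1.congr fun n => ?_)
    rw [hu, Finset.sum_smul]
    refine Finset.sum_congr rfl fun s hs => ?_
    change _ = c n s • HilbertComplexification.ofReal (f (x + s • (0 : E)))
    rw [smul_zero, add_zero]

end Kernel

/-! ### Kernels of analytic maps -/

section InnerProduct

variable {𝕜 H : Type*} [RCLike 𝕜] [NormedAddCommGroup H] [InnerProductSpace 𝕜 H]
  [NormedSpace ℝ H] [IsScalarTower ℝ 𝕜 H]

theorem inner_real_smul_left_of_tower (r : ℝ) (x y : H) :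
    inner 𝕜 (r • x) y = r • inner 𝕜 x y := by
  rw [RCLike.real_smul_eq_coe_smul (K := 𝕜) r x, inner_smul_left, RCLike.conj_ofReal,
    RCLike.real_smul_eq_coe_mul]

theorem inner_real_smul_right_of_tower (r : ℝ) (x y : H) :
    inner 𝕜 x (r • y) = r • inner 𝕜 x y := by
  rw [RCLike.real_smul_eq_coe_smul (K := 𝕜) r y, inner_smul_right,
    RCLike.real_smul_eq_coe_mul]

variable (𝕜 H) in
/-- The real part of the inner product makes `H` a real inner product space. The given real normed
space structure is kept as it is, so that no second scalar multiplication by `ℝ` appears on `H`. -/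
abbrev realPartInnerProductSpace : InnerProductSpace ℝ H where
  inner x y := RCLike.re (inner 𝕜 x y)
  norm_sq_eq_re_inner x := norm_sq_eq_re_inner (𝕜 := 𝕜) x
  conj_inner_symm x y := by
    rw [conj_trivial]
    exact inner_re_symm y x
  add_left x y z := by rw [inner_add_left, map_add]
  smul_left x y r := by
    rw [inner_real_smul_left_of_tower, RCLike.smul_re]
    rfl

variable (𝕜 H) in
/-- The inner product as a real bilinear map. -/
noncomputable def innerBilinReal : H →ₗ[ℝ] H →ₗ[ℝ] 𝕜 :=
  LinearMap.mk₂ ℝ (fun x y => inner 𝕜 x y) (fun _ _ _ => inner_add_left _ _ _)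
    inner_real_smul_left_of_tower (fun _ _ _ => inner_add_right _ _ _)
    fun r x y => inner_real_smul_right_of_tower r x y

end InnerProduct

section Local

open Complexification

variable {𝕜 H : Type*} [RCLike 𝕜] [NormedAddCommGroup H] [InnerProductSpace 𝕜 H]
  [NormedSpace ℝ H] [IsScalarTower ℝ 𝕜 H]
  {E E' : Type*} [AddCommGroup E] [Module ℝ E] [TopologicalSpace E]
  [IsTopologicalAddGroup E] [ContinuousSMul ℝ E]
  [AddCommGroup E'] [Module ℝ E'] [TopologicalSpace E']
  [IsTopologicalAddGroup E'] [ContinuousSMul ℝ E']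

theorem IsRealAnalyticOn.inner_prod {f : E → H} {f' : E' → H} {U : Set E} {U' : Set E'}
    {S : Set (E × E')} (hf : IsRealAnalyticOn f U) (hf' : IsRealAnalyticOn f' U')
    (hS : S ⊆ U ×ˢ U') : IsRealAnalyticOn (fun p : E × E' => inner 𝕜 (f p.1) (f' p.2)) S := by
  rintro ⟨x, x'⟩ hx
  obtain ⟨V, hV, hxV, g, hg, hgf⟩ := hf x (hS hx).1
  obtain ⟨V', hV', hxV', g', hg', hgf'⟩ := hf' x' (hS hx).2
  set A := Complexification.map (ContinuousLinearMap.fst ℝ E E')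
  set A' := Complexification.map (ContinuousLinearMap.snd ℝ E E')
  have ho : IsOpen (A ⁻¹' V ∩ A' ⁻¹' V') :=
    (hV.preimage A.continuous).inter (hV'.preimage A'.continuous)
  refine ⟨A ⁻¹' V ∩ A' ⁻¹' V', ho, ⟨hxV, hxV'⟩,
    fun z => map₂ (innerBilinReal 𝕜 H) (g (A z)) (g' (A' z)), ?_, ?_⟩
  · exact ((hg.comp_clm A).mono Set.inter_subset_left).bilinear ho
      ((hg'.comp_clm A').mono Set.inter_subset_right) _ (continuous_map₂ _ continuous_inner)
  · rintro ⟨y, y'⟩ hy ⟨hyV, hyV'⟩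
    have h1 : A (ofReal (y, y')) = ofReal y := map_ofReal _ _
    have h2 : A' (ofReal (y, y')) = ofReal y' := map_ofReal _ _
    rw [Set.mem_preimage, h1] at hyV
    rw [Set.mem_preimage, h2] at hyV'
    beta_reduce
    rw [h1, h2, hgf y (hS hy).1 hyV, hgf' y' (hS hy).2 hyV', map₂_ofReal]
    rfl

/-- A map is analytic if its kernel is analytic near the diagonal. -/
theorem isRealAnalyticOn_of_kernel [CompleteSpace H] {f : E → H} {U : Set E} {S : Set (E × E)}
    (hS : IsOpen S) (hU : ∀ x ∈ U, (x, x) ∈ S)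
    (hf : IsRealAnalyticOn (fun p : E × E => inner 𝕜 (f p.1) (f p.2)) S) :
    IsRealAnalyticOn f U := by
  let _ := realPartInnerProductSpace 𝕜 H
  intro x₀ hx₀
  obtain ⟨V, hV, hxV, G, hG, hGf⟩ := hf (x₀, x₀) (hU x₀ hx₀)
  set P : Complexification E × Complexification E →L[ℂ] Complexification (E × E) := prodMk
  set R : Complexification 𝕜 →L[ℂ] ℂ := extendRe RCLike.reCLM
  set k : Complexification E × Complexification E → ℂ := fun p => R (G (P p))
  have hk : IsHolomorphicOn k (P ⁻¹' V) := (hG.clm_comp R).comp_clm P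
  have hVo : IsOpen (P ⁻¹' V) := hV.preimage P.continuous
  have e1 : ∀ᶠ p in 𝓝 (ofReal x₀, ofReal x₀), p ∈ P ⁻¹' V := hVo.mem_nhds hxV
  have e2 : ∀ᶠ p in 𝓝 (ofReal x₀, ofReal x₀),
      ‖k p‖ < ‖k (ofReal x₀, ofReal x₀)‖ + 1 :=
    (hk.1.continuousAt e1).norm.eventually_lt continuousAt_const (lt_add_one _)
  have hfst : Continuous fun z : Complexification E => z.1 := continuous_fst (X := E) (Y := E)
  have hre : Continuous fun p : Complexification E × Complexification E => (p.1.1, p.2.1) :=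
    (hfst.comp continuous_fst).prodMk (hfst.comp continuous_snd)
  have e3 : ∀ᶠ p : Complexification E × Complexification E in 𝓝 (ofReal x₀, ofReal x₀),
      (p.1.1, p.2.1) ∈ S :=
    hre.continuousAt.eventually_mem (hS.mem_nhds (hU x₀ hx₀))
  obtain ⟨u, v, hu, hxu, hv, hxv, huv⟩ := mem_nhds_prod_iff'.1 (e1.and (e2.and e3))
  have hsub : ∀ p ∈ (u ∩ v) ×ˢ (u ∩ v), p ∈ u ×ˢ v := fun p hp => ⟨hp.1.1, hp.2.2⟩
  have hkf : ∀ x y : E, ofReal x ∈ u ∩ v → ofReal y ∈ u ∩ v →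
      k (ofReal x, ofReal y) = ((inner ℝ (f x) (f y) : ℝ) : ℂ) := by
    intro x y hx hy
    have h := huv (hsub (ofReal x, ofReal y) ⟨hx, hy⟩)
    have hP : P (ofReal x, ofReal y) = ofReal (x, y) := prodMk_ofReal x y
    have hm : P (ofReal x, ofReal y) ∈ V := h.1
    change R (G (P (ofReal x, ofReal y))) = _
    rw [hP] at hm ⊢
    rw [hGf (x, y) h.2.2 hm, extendRe_ofReal]
    rfl
  obtain ⟨V', hV', hxV', F, hF, hFf⟩ := exists_holomorphic_feature_map (f := f) (hu.inter hv)
    ⟨hxu, hxv⟩ (hk.mono fun p hp => (huv (hsub p hp)).1)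
    (fun p hp => (huv (hsub p hp)).2.1.le) hkf
  refine ⟨V', hV', hxV', fun z => HilbertComplexification.toComplexificationCLM (F z),
    hF.clm_comp _, fun y _ hy => ?_⟩
  beta_reduce
  rw [hFf y hy, HilbertComplexification.toComplexificationCLM_ofReal]

end Local

theorem theorem5p1 {𝕜 : Type*} [RCLike 𝕜]
    -- the model space `E` is a real Fréchet space
    {E : Type*} [AddCommGroup E] [Module ℝ E] [UniformSpace E] [IsUniformAddGroup E]
    [ContinuousSMul ℝ E] [LocallyConvexSpace ℝ E] [TopologicalSpace.MetrizableSpace E]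
    [CompleteSpace E]
    {M : Type*} [TopologicalSpace M] [ChartedSpace E M] [IsRealAnalyticManifold E M]
    -- `H` is a real or complex Hilbert space
    {H : Type*} [NormedAddCommGroup H] [InnerProductSpace 𝕜 H] [CompleteSpace H]
    [NormedSpace ℝ H] [IsScalarTower ℝ 𝕜 H]
    (γ : M → H) :
    IsManifoldAnalyticOn E γ Set.univ ↔
      ∃ W : Set (M × M), IsOpen W ∧ (∀ x : M, (x, x) ∈ W) ∧
        IsManifoldAnalyticOn (E × E) (fun p : M × M => inner 𝕜 (γ p.1) (γ p.2)) W := by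
  constructor
  · intro h
    refine ⟨Set.univ, isOpen_univ, fun _ => Set.mem_univ _, ?_⟩
    rintro _ ⟨e, he, e', he', rfl⟩
    exact (h e he).inner_prod (h e' he') fun p hp => ⟨⟨hp.1.1, trivial⟩, ⟨hp.1.2, trivial⟩⟩
  · rintro ⟨W, hW, hdiag, h⟩ e he
    have hK := h (e.prod e) (Set.mem_image2_of_mem he he)
    exact isRealAnalyticOn_of_kernel (𝕜 := 𝕜) ((e.prod e).isOpen_inter_preimage_symm hW)
      (fun x hx => ⟨⟨hx.1, hx.1⟩, hdiag _⟩) hK
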